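/- **Model.** A finite set $\Pi$ of nodes is connected by a connected graph (the initial graph); nodes adjacent in it are called neighbors. Nodes fail only by crashing, and a crashed node takes no further steps; a node is correct if it never crashes. Node $p$ has an integer-valued local clock that ticks at a constant rate (rates and offsets may differ between nodes) and a positive integer heartbeat period $T_p$; the initial clock reading is at most $T_p$. Each link consists of two unidirectional ADD channels: messages may be reordered, arbitrarily delayed or lost, but are not duplicated; some messages are privileged, and there are unknown bounds $d,r$ for the channel such that every privileged message is delivered within real time $d$ and every run of consecutive messages sent on the channel without a privileged one has at most $r$ members. **Algorithm at node $p$.** Variables, with initial values: $last\_contact[q]=0$ and $timeout[q]=T_p$ for neighbors $q$; $suspect\_local[r]=suspect[r]=\mathrm{false}$ for all $r\in\Pi$; $paths[p]=\{p\}$, $paths[q]=\{q\cdot p\}$ for neighbors $q$, and $paths[r]=\emptyset$ otherwise. Paths are finite sequences of nodes, the length of a path is its number of hops, and the length of a shortest path in an empty set is $\infty$. * *Heartbeat.* Whenever $clock()=nT_p$ with $n\in\mathbb N$, $p$ sends $\langle suspect\_local,paths,p\rangle$ to all its neighbors (during that clock tick). * *Timer.* When $clock()-last\_contact[q]=timeout[q]$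 for a neighbor $q$, $p$ sets $suspect\_local[q]:=\mathrm{true}$ (before the clock advances). * *Receipt of $\langle suspect\_rcv,path\_sets,q\rangle$.* If $suspect\_local[q]$ is true, then $timeout[q]:=2(clock()-last\_contact[q])$ and $suspect\_local[q]:=\mathrm{false}$. Then $last\_contact[q]:=clock()$. Next, for each non-neighbor $r$ of $p$ (including $p$ itself), one after the other in an arbitrary order: let $h'$ be the length of a shortest path in $path\_sets[r]$ that contains neither $p$ nor a node $u\neq r$ with $suspect\_rcv[u]$ true, and let $h$ be the length of a shortest path in $paths[r]$ that contains no node $u\ne r$ with $suspect\_local[u]$ true; if $h'<h$, set $suspect\_local[r]:=suspect\_rcv[r]$; then add $\pi\cdot p$ to $paths[r]$ for every $\pi\in path\_sets[r]$ that does not contain $p$. Finally set $suspect:=suspect\_local$ and, for each non-neighbor $r$ of $p$ such that every path in $paths[r]$ contains some $u\ne r$ with $suspect\_local[u]$ true, set $suspect[r]:=\mathrm{true}$. Node $p$ *suspects* $q$ at time $t$ if $p$'s variable $suspect[q]$ is true at $t$. In an execution, finitely many events happen in every bounded interval of real time. The *final network graph* $\mathbb G$ of an execution is obtained from the initial graph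 by deleting all nodes that ever crash, with their incident links. **Theorem (eventual strong accuracy).** In every execution there is a time $t_f$ such that for all $t>t_f$ and all correct nodes $p,q$ in the same connected component of $\mathbb G$, $p$ does not suspect $q$ at time $t$ and $q$ does not suspect $p$ at time $t$. -/

import Mathlib

namespace Heartbeat

/-- The static data of a partitionable network: the connected initial graph, the heartbeat period
`T` of every node (a positive integer number of ticks), and for every node a local clock that
ticks at a constant rate. Rates and offsets differ from node to node. The initial timers, which
are due at clock value `T`, are not already in the past at time `0`. -/
structure Network (V : Type*) where
  graph : SimpleGraph V
  connected : graph.Connected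
  period : V → ℕ
  period_pos : ∀ p, 0 < period p
  rate : V → ℝ
  rate_pos : ∀ p, 0 < rate p
  offset : V → ℝ
  offset_le : ∀ p, ⌊offset p⌋ ≤ (period p : ℤ)

/-- The reading `clock()` of the local clock of `p` at real time `t`, an integer. -/
noncomputable def Network.clock {V : Type*} (N : Network V) (p : V) (t : ℝ) : ℤ :=
  ⌊N.rate p * t + N.offset p⌋

/-- The variables of one node. A path is a list of node ids; a path in `paths r` at `p` starts
with `r` and ends with `p`. `lastContact` and `timeout` are used at neighbors only. -/
structure LocalState (V : Type*) where
  crashed : Bool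
  lastContact : V → ℤ
  timeout : V → ℤ
  suspectLocal : V → Bool
  paths : V → Set (List V)
  suspect : V → Bool

open Classical in
/-- The initial values of the variables of node `p`. -/
noncomputable def initialState {V : Type*} (N : Network V) (p : V) : LocalState V where
  crashed := false
  lastContact := fun _ => 0
  timeout := fun _ => (N.period p : ℤ)
  suspectLocal := fun _ => false
  paths := fun r => if r = p then {[p]} else if N.graph.Adj r p then {[r, p]} else ∅
  suspect := fun _ => false

/-- The contents of a heartbeat message. -/
structure Message (V : Type*) where
  suspectRcv : V → Bool
  pathSets : V → Set (List V)

/-- The heartbeat message that a node with local state `s` sends. -/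
def LocalState.message {V : Type*} (s : LocalState V) : Message V where
  suspectRcv := s.suspectLocal
  pathSets := s.paths

/-- The length (number of hops) of a shortest path in `P`; it is `⊤` if `P` is empty. -/
noncomputable def shortestLength {V : Type*} (P : Set (List V)) : ℕ∞ :=
  ⨅ π ∈ P, ((π.length - 1 : ℕ) : ℕ∞)

/-- The length of the shortest path in `pathSets r` that contains neither `p` nor a node `u ≠ r`
suspected in the message. -/
noncomputable def hopFromMsg {V : Type*} (p : V) (m : Message V) (r : V) : ℕ∞ :=
  shortestLength {π | π ∈ m.pathSets r ∧ p ∉ π ∧ ∀ u ∈ π, u ≠ r → m.suspectRcv u = false}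

/-- The length of the shortest path in `paths r` that contains no locally suspected node
`u ≠ r`. -/
noncomputable def hop {V : Type*} (s : LocalState V) (r : V) : ℕ∞ :=
  shortestLength {π | π ∈ s.paths r ∧ ∀ u ∈ π, u ≠ r → s.suspectLocal u = false}

open Classical in
/-- First part of the processing of a message of neighbor `q` at clock value `c`: if `q` is
suspected, its timeout is adjusted and the suspicion is withdrawn; then the contact is
recorded. -/
noncomputable def recordContact {V : Type*} (c : ℤ) (q : V) (s : LocalState V) :
    LocalState V :=
  { s with
    timeout := fun u =>
      if u = q ∧ s.suspectLocal q = true then 2 * (c - s.lastContact q) else s.timeout u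
    suspectLocal := fun u => if u = q then false else s.suspectLocal u
    lastContact := fun u => if u = q then c else s.lastContact u }

open Classical in
/-- One iteration, for the node `r`, of the loop over the non-neighbors of `p` in the processing
of the message `m`. -/
noncomputable def processNode {V : Type*} (p : V) (m : Message V) (s : LocalState V) (r : V) :
    LocalState V :=
  { s with
    suspectLocal := fun u =>
      if u = r ∧ hopFromMsg p m r < hop s r then m.suspectRcv r else s.suspectLocal u
    paths := fun u =>
      if u = r then s.paths r ∪ {π | ∃ ρ ∈ m.pathSets r, p ∉ ρ ∧ π = ρ ++ [p]} else s.paths u }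

open Classical in
/-- Last part of the processing of a message: `suspect` is recomputed from `suspectLocal` and
`paths`. -/
noncomputable def deriveSuspect {V : Type*} (G : SimpleGraph V) (p : V) (s : LocalState V) :
    LocalState V :=
  { s with
    suspect := fun r =>
      if ¬ G.Adj p r ∧ ∀ π ∈ s.paths r, ∃ u ∈ π, u ≠ r ∧ s.suspectLocal u = true then true
      else s.suspectLocal r }

/-- `ReceiveEffect G p q c m s s'`: at clock value `c` node `p` in state `s` processes the message
`m` of its neighbor `q` and is in state `s'` afterwards. The loop over all non-neighbors of `p`
runs through them one after the other, in an arbitrary order. -/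
def ReceiveEffect {V : Type*} (G : SimpleGraph V) (p q : V) (c : ℤ) (m : Message V)
    (s s' : LocalState V) : Prop :=
  ∃ order : List V, order.Nodup ∧ (∀ r, r ∈ order ↔ ¬ G.Adj p r) ∧
    s' = deriveSuspect G p (order.foldl (processNode p m) (recordContact c q s))

open Classical in
/-- The effect of the expiry of the timer for `q`. -/
noncomputable def expireEffect {V : Type*} (q : V) (s : LocalState V) : LocalState V :=
  { s with suspectLocal := fun u => if u = q then true else s.suspectLocal u }

/-- The events of an execution. `heartbeat p`: node `p` sends its current heartbeat message to
each of its neighbors. `receive i p`: node `p` receives the message sent to it in step `i`. -/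
inductive Event (V : Type*) where
  | idle : Event V
  | crash (p : V) : Event V
  | heartbeat (p : V) : Event V
  | receive (i : ℕ) (p : V) : Event V
  | expire (p q : V) : Event V

open Classical in
/-- `IsStep N time event state n`: event number `n`, at real time `time n`, is possible in the
configuration `state n` and leads to the configuration `state (n + 1)`. Crashed nodes take no
steps. -/
def IsStep {V : Type*} (N : Network V) (time : ℕ → ℝ) (event : ℕ → Event V)
    (state : ℕ → V → LocalState V) (n : ℕ) : Prop :=
  match event n with
  | .idle => state (n + 1) = state n
  | .crash p =>
      (state n p).crashed = false ∧
      state (n + 1) = Function.update (state n) p { state n p with crashed := true }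
  | .heartbeat p =>
      (state n p).crashed = false ∧
      (∃ k : ℕ, N.clock p (time n) = k * N.period p) ∧
      state (n + 1) = state n
  | .receive i p =>
      (state n p).crashed = false ∧
      ∃ q, i < n ∧ event i = .heartbeat q ∧ N.graph.Adj q p ∧
        ∃ s', ReceiveEffect N.graph p q (N.clock p (time n)) (state i q).message (state n p) s' ∧
          state (n + 1) = Function.update (state n) p s'
  | .expire p q =>
      (state n p).crashed = false ∧ N.graph.Adj p q ∧
      (state n p).timeout q = N.clock p (time n) - (state n p).lastContact q ∧
      state (n + 1) = Function.update (state n) p (expireEffect q (state n p))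

/-- The channel from `q` to `p` is an ADD channel. A message on it is named by the step in which
`q` sends it. Some of the messages are privileged. For some bounds `d` and `r`, every privileged
message reaches `p` within time `d` of being sent (and is then received, unless `p` has crashed by
then), and every run of consecutive messages without a privileged one has at most `r` members.
All other messages may be delayed arbitrarily, reordered or lost. -/
def IsADDChannel {V : Type*} (time : ℕ → ℝ) (event : ℕ → Event V) (q p : V) : Prop :=
  ∃ (privileged : Set ℕ) (d : ℝ) (r : ℕ),
    (∀ i ∈ privileged, event i = .heartbeat q →
      (∃ n, event n = .receive i p ∧ time n ≤ time i + d) ∨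
      (∃ n, event n = .crash p ∧ time n ≤ time i + d)) ∧
    (∀ i j, (∀ m, i ≤ m → m < j → event m = .heartbeat q → m ∉ privileged) →
      {m | i ≤ m ∧ m < j ∧ event m = .heartbeat q}.ncard ≤ r)

/-- An execution of the algorithm: a sequence of events, the real times at which they happen, and
the configurations before and after them. -/
structure Execution {V : Type*} (N : Network V) where
  time : ℕ → ℝ
  event : ℕ → Event V
  state : ℕ → V → LocalState V
  time_nonneg : 0 ≤ time 0
  time_mono : Monotone time
  time_diverges : Filter.Tendsto time Filter.atTop Filter.atTop
  state_zero : ∀ p, state 0 p = initialState N p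
  isStep : ∀ n, IsStep N time event state n
  /-- Whenever the clock of `p` shows a multiple of the period, `p` sends a heartbeat during that
  tick, unless it crashes first. -/
  heartbeat_taken : ∀ (p : V) (k : ℕ), N.clock p 0 ≤ k * N.period p →
    (∃ n, event n = .heartbeat p ∧ N.clock p (time n) = k * N.period p) ∨
    (∃ n, event n = .crash p ∧ N.clock p (time n) ≤ k * N.period p)
  /-- The clock of a live node does not run past the value at which the timer of a neighbor is
  due, unless the expiry has taken place, so that the neighbor is suspected. -/
  expiry_taken : ∀ (n : ℕ) (p q : V), (state n p).crashed = false → N.graph.Adj p q →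
    (state n p).suspectLocal q = false →
    N.clock p (time n) ≤ (state n p).lastContact q + (state n p).timeout q
  /-- No message is delivered twice. -/
  no_duplicates : ∀ (i : ℕ) (p : V) (m n : ℕ),
    event m = .receive i p → event n = .receive i p → m = n
  channels : ∀ q p, N.graph.Adj q p → IsADDChannel time event q p

namespace Execution

variable {V : Type*} {N : Network V}

/-- Node `p` is crashed at real time `t`. -/
def CrashedAt (X : Execution N) (t : ℝ) (p : V) : Prop :=
  ∃ n, X.event n = .crash p ∧ X.time n ≤ t

/-- A node is correct if it never crashes. -/
def Correct (X : Execution N) (p : V) : Prop :=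
  ∀ t, ¬ X.CrashedAt t p

/-- The network graph at time `t`: the nodes crashed at time `t` are deleted from the initial
graph, with their incident links. -/
def networkGraph (X : Execution N) (t : ℝ) : N.graph.Subgraph :=
  (⊤ : N.graph.Subgraph).deleteVerts {p | X.CrashedAt t p}

/-- The final network graph: all nodes that ever crash are deleted from the initial graph. -/
def finalNetworkGraph (X : Execution N) : N.graph.Subgraph :=
  (⊤ : N.graph.Subgraph).deleteVerts {p | ¬ X.Correct p}

/-- The final network graph is the network graph at every time at which all failures have
occurred. -/
theorem networkGraph_eq_final (X : Execution N) (t : ℝ)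
    (ht : ∀ p, ¬ X.Correct p → X.CrashedAt t p) : X.networkGraph t = X.finalNetworkGraph := by
  have h : {p | X.CrashedAt t p} = {p | ¬ X.Correct p} :=
    Set.ext fun p => ⟨fun hp hc => hc t hp, ht p⟩
  rw [networkGraph, finalNetworkGraph, h]

/-- Configuration number `n` is in force from the time of the event before it to the time of the
event after it. -/
def InForce (X : Execution N) (n : ℕ) (t : ℝ) : Prop :=
  (∀ k, k < n → X.time k ≤ t) ∧ t ≤ X.time n

/-- Node `p` suspects node `q` at real time `t` (if several events happen at time `t`: in one of
the configurations in force at time `t`). -/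
def SuspectsAt (X : Execution N) (t : ℝ) (p q : V) : Prop :=
  ∃ n, X.InForce n t ∧ (X.state n p).suspect q = true

end Execution

end Heartbeat

/-! Measure the distance from `r` to a correct node `p` along walks whose nodes after `r` are
correct; `r` itself may have crashed. By induction on `k`, the local flags of every correct node are
eventually right about all nodes at distance less than `k`, crashed or not (`eventually_accurate`).
Crashed nodes have to be included because a path through one is discarded only if that node is
flagged.

Distance 0 is an invariant: no node flags itself. Distance 1 is the timer argument. A crashed
neighbor falls silent for good, since messages are not duplicated and so each old one arrives at
most once. For a correct neighbor the ADD property bounds the silence, while every withdrawn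
suspicion at least doubles the timeout.

For distance `k ≥ 2`, all recorded paths are simple paths of the initial graph. If flags are right
below distance `k`, an unflagged path of length at most `k` really runs through correct nodes:
otherwise its last crashed node would be nearer than `k`, hence flagged (`Accurate.reach`). So once
a shortest path is known, `h = k`. Any message with `h' < h` then comes from a sender nearer than
`k` to `r`, whose flag for `r` is right, and the predecessor of `p` on a shortest walk does send
such messages. The flag becomes right and is never spoiled (`eventually_suspectLocal_iff`).

Finally, a shortest path through correct nodes keeps `suspect` from being raised for want of an
unflagged path (`eventually_not_suspect`). -/

namespace Heartbeat

/-! ### Walks through good nodes, recorded paths and accuracy of flags. -/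

variable {V : Type*} {G : SimpleGraph V} {ok : V → Prop}

/-- `Reach G ok k r p`: there is a walk of length `k` from `r` to `p` in `G` all of whose nodes
after the first satisfy `ok`. -/
inductive Reach (G : SimpleGraph V) (ok : V → Prop) : ℕ → V → V → Prop
  | refl (r : V) : Reach G ok 0 r r
  | step {k : ℕ} {r q p : V} : Reach G ok k r q → G.Adj q p → ok p → Reach G ok (k + 1) r p

theorem Reach.cons {k : ℕ} {a b p : V} (hab : G.Adj a b) (hb : ok b) (h : Reach G ok k b p) :
    Reach G ok (k + 1) a p := by
  induction h with
  | refl r => exact .step (.refl a) hab hb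
  | step _ hadj hp ih => exact .step (ih hab hb) hadj hp

theorem Reach.eq_of_zero {r p : V} (h : Reach G ok 0 r p) : r = p := by
  cases h; rfl

theorem Reach.adj_of_one {r p : V} (h : Reach G ok 1 r p) : G.Adj r p := by
  cases h with
  | step h1 hadj _ => exact h1.eq_of_zero ▸ hadj

/-- `k` is the least length of a walk as in `Reach`. -/
def IsDist (G : SimpleGraph V) (ok : V → Prop) (k : ℕ) (r p : V) : Prop :=
  Reach G ok k r p ∧ ∀ i < k, ¬ Reach G ok i r p

theorem Reach.exists_isDist {k : ℕ} {r p : V} (h : Reach G ok k r p) :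
    ∃ j ≤ k, IsDist G ok j r p := by
  classical
  have hex : ∃ j, Reach G ok j r p := ⟨k, h⟩
  exact ⟨Nat.find hex, Nat.find_min' hex h, Nat.find_spec hex, fun i hi => Nat.find_min hex hi⟩

theorem IsDist.pred {k : ℕ} {r p : V} (h : IsDist G ok (k + 1) r p) :
    ∃ q, IsDist G ok k r q ∧ G.Adj q p ∧ ok p := by
  obtain ⟨h1, h2⟩ := h
  cases h1 with
  | @step _ _ q _ hq hadj hp =>
    exact ⟨q, ⟨hq, fun i hi hr => h2 (i + 1) (by omega) (.step hr hadj hp)⟩, hadj, hp⟩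

theorem IsDist.target_ok {k : ℕ} {r q : V} (hq : IsDist G ok (k + 1) r q) : ok q := by
  cases hq.1 with
  | step _ _ hok => exact hok

/-- `π` is a simple path of `G` from `r` to `p`. -/
def IsSimplePath (G : SimpleGraph V) (r p : V) (π : List V) : Prop :=
  π.head? = some r ∧ π.getLast? = some p ∧ π.Nodup ∧ π.IsChain G.Adj

theorem IsSimplePath.concat {r q p : V} {ρ : List V} (h : IsSimplePath G r q ρ)
    (hadj : G.Adj q p) (hp : p ∉ ρ) : IsSimplePath G r p (ρ ++ [p]) := by
  obtain ⟨h1, h2, h3, h4⟩ := h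
  refine ⟨by simp [h1], by simp, ?_, ?_⟩
  · rw [List.nodup_append]
    refine ⟨h3, by simp, ?_⟩
    intro a ha b hb
    simp only [List.mem_singleton] at hb
    rintro rfl
    exact hp (hb ▸ ha)
  · rw [List.isChain_append]
    refine ⟨h4, by simp, ?_⟩
    intro x hx y hy
    simp_all

/-- A simple path either is a walk as in `Reach`, or its last node violating `ok` is reached from
there by a shorter such walk. -/
theorem IsSimplePath.reach_or_exists {p : V} {π : List V} {r : V} (h : IsSimplePath G r p π) :
    Reach G ok (π.length - 1) r p ∨
      ∃ u ∈ π, u ≠ r ∧ ¬ ok u ∧ ∃ j < π.length - 1, Reach G ok j u p := by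
  induction π generalizing r with
  | nil => simp [IsSimplePath] at h
  | cons a l ih =>
    obtain ⟨h1, h2, h3, h4⟩ := h
    obtain rfl : a = r := by simpa using h1
    cases l with
    | nil =>
      obtain rfl : a = p := by simpa using h2
      exact .inl (.refl _)
    | cons b l =>
      rw [List.isChain_cons_cons] at h4
      rw [List.nodup_cons] at h3
      have hb : IsSimplePath G b p (b :: l) :=
        ⟨rfl, by simpa using h2, h3.2, h4.2⟩
      rcases ih hb with hr | ⟨u, hu, -, hbad, j, hj, hr⟩
      · by_cases hok : ok b
        · exact .inl (hr.cons h4.1 hok)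
        · refine .inr ⟨b, by simp, ?_, hok, _, ?_, hr⟩
          · rintro rfl
            exact h3.1 (by simp)
          · simp
      · refine .inr ⟨u, List.mem_cons_of_mem _ hu, ?_, hbad, j, ?_, hr⟩
        · rintro rfl
          exact h3.1 hu
        · simp at hj ⊢
          omega

/-- At `p`, the flags `f` tell exactly which nodes within distance `< k` violate `ok`. -/
def Accurate (G : SimpleGraph V) (ok : V → Prop) (k : ℕ) (p : V) (f : V → Bool) : Prop :=
  ∀ j < k, ∀ u, Reach G ok j u p → (f u = true ↔ ¬ ok u)

theorem Accurate.mono {j k : ℕ} {p : V} {f : V → Bool} (h : Accurate G ok k p f) (hjk : j ≤ k) :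
    Accurate G ok j p f :=
  fun i hi => h i (hi.trans_le hjk)

/-- A bad node on the path other than `r` would give one with a walk to `p` shorter than `k`;
accuracy would flag it, against `hu`. -/
theorem Accurate.reach {k : ℕ} {r p : V} {f : V → Bool} (hf : Accurate G ok k p f) {π : List V}
    (hπ : IsSimplePath G r p π) (hk : π.length - 1 ≤ k)
    (hu : ∀ u ∈ π, u ≠ r → f u = false) : Reach G ok (π.length - 1) r p := by
  rcases hπ.reach_or_exists (ok := ok) with h | ⟨u, hmem, hne, hbad, j, hj, hr⟩
  · exact h
  · have h1 := (hf j (hj.trans_le hk) u hr).2 hbad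
    rw [hu u hmem hne] at h1
    cases h1

/-- Among the paths `P` from `r` to `p` there is one of length `k` that runs, after `r`, through
nodes satisfying `ok`. -/
def HasGoodPath (G : SimpleGraph V) (ok : V → Prop) (k : ℕ) (r p : V) (P : Set (List V)) : Prop :=
  ∃ π ∈ P, π.length = k + 1 ∧ ∀ u ∈ π, (∃ i ≤ k, Reach G ok i r u) ∧
    (u ≠ r → ok u ∧ ∃ j < k, Reach G ok j u p)

theorem HasGoodPath.mono {k : ℕ} {r p : V} {P Q : Set (List V)} (h : HasGoodPath G ok k r p P)
    (hPQ : P ⊆ Q) : HasGoodPath G ok k r p Q := by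
  obtain ⟨π, hπ, h'⟩ := h
  exact ⟨π, hPQ hπ, h'⟩

/-- The nodes of the path are within `k` of `r`, whereas `p` is not. This is the use of the first
bound in `HasGoodPath`; the second places these nodes within the range of accurate flags. -/
theorem HasGoodPath.not_mem {k : ℕ} {r q p : V} {P : Set (List V)}
    (hdist : IsDist G ok (k + 1) r p) (h : HasGoodPath G ok k r q P) :
    ∃ π ∈ P, p ∉ π ∧ π.length = k + 1 ∧ ∀ u ∈ π, (∃ i ≤ k, Reach G ok i r u) ∧
      (u ≠ r → ok u ∧ ∃ j < k, Reach G ok j u q) := by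
  obtain ⟨π, hπ, hlen, hall⟩ := h
  refine ⟨π, hπ, fun hp => ?_, hlen, hall⟩
  obtain ⟨i, hi, hr⟩ := (hall p hp).1
  exact hdist.2 i (by omega) hr

theorem HasGoodPath.concat {k : ℕ} {r q p : V} {P Q : Set (List V)}
    (hdist : IsDist G ok (k + 1) r p) (h : HasGoodPath G ok k r q P) (hadj : G.Adj q p)
    (hp : ok p) (hQ : ∀ π ∈ P, p ∉ π → π ++ [p] ∈ Q) : HasGoodPath G ok (k + 1) r p Q := by
  obtain ⟨π, hπ, hpπ, hlen, hall⟩ := h.not_mem hdist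
  refine ⟨π ++ [p], hQ π hπ hpπ, by simp [hlen], fun u hu => ?_⟩
  rw [List.mem_append, List.mem_singleton] at hu
  rcases hu with hu | rfl
  · obtain ⟨⟨i, hi, hr⟩, h2⟩ := hall u hu
    refine ⟨⟨i, by omega, hr⟩, fun hne => ?_⟩
    obtain ⟨hok, j, hj, hrj⟩ := h2 hne
    exact ⟨hok, j + 1, by omega, .step hrj hadj hp⟩
  · exact ⟨⟨_, le_rfl, hdist.1⟩, fun _ => ⟨hp, 0, by omega, .refl _⟩⟩

/-! ### The hop counts `h'` and `h` under accurate flags. -/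

section Hops

variable {k : ℕ} {r q p : V} {s : LocalState V} {m : Message V}

theorem shortestLength_lt_iff {P : Set (List V)} {x : ℕ∞} :
    shortestLength P < x ↔ ∃ π ∈ P, ((π.length - 1 : ℕ) : ℕ∞) < x := by
  simp [shortestLength, iInf_lt_iff]

/-- The path realizing `h'` is unflagged, so by `Accurate.reach` it is a genuine walk to the sender,
short enough for the sender's accuracy to cover `r`. -/
theorem suspectRcv_iff_of_hopFromMsg_lt (hm : Accurate G ok k q m.suspectRcv)
    (hv : ∀ π ∈ m.pathSets r, IsSimplePath G r q π) (hlt : hopFromMsg p m r < k) :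
    m.suspectRcv r = true ↔ ¬ ok r := by
  obtain ⟨π, ⟨hπ, -, hu⟩, hlen⟩ := shortestLength_lt_iff.1 hlt
  have hlen' : π.length - 1 < k := by exact_mod_cast hlen
  exact hm _ hlen' r (hm.reach (hv π hπ) hlen'.le hu)

theorem hop_le (hs : Accurate G ok k p s.suspectLocal) (h : HasGoodPath G ok k r p (s.paths r)) :
    hop s r ≤ k := by
  obtain ⟨π, hπ, hlen, hall⟩ := h
  have : hop s r ≤ ((π.length - 1 : ℕ) : ℕ∞) := by
    refine iInf₂_le π ⟨hπ, fun u hu hne => ?_⟩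
    obtain ⟨hok, j, hj, hr⟩ := (hall u hu).2 hne
    have := hs j hj u hr
    simpa [hok] using this
  simpa [hlen] using this

/-- A shorter unflagged path would be a genuine walk below the distance. With `hop_le` this gives `h
= k`. -/
theorem le_hop (hs : Accurate G ok k p s.suspectLocal)
    (hv : ∀ π ∈ s.paths r, IsSimplePath G r p π) (hdist : IsDist G ok k r p) :
    (k : ℕ∞) ≤ hop s r := by
  by_contra! hlt
  obtain ⟨π, ⟨hπ, hu⟩, hlen⟩ := shortestLength_lt_iff.1 hlt
  have hlen' : π.length - 1 < k := by exact_mod_cast hlen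
  exact hdist.2 _ hlen' (hs.reach (hv π hπ) hlen'.le hu)

/-- Strictness comes from `h'` not counting the last hop from `q` to `p`. -/
theorem hopFromMsg_lt (hm : Accurate G ok k q m.suspectRcv)
    (h : HasGoodPath G ok k r q (m.pathSets r)) (hdist : IsDist G ok (k + 1) r p) :
    hopFromMsg p m r < (k + 1 : ℕ) := by
  obtain ⟨π, hπ, hp, hlen, hall⟩ := h.not_mem hdist
  refine shortestLength_lt_iff.2 ⟨π, ⟨hπ, hp, fun u hu hne => ?_⟩, ?_⟩
  · obtain ⟨hok, j, hj, hr⟩ := (hall u hu).2 hne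
    have := hm j hj u hr
    simpa [hok] using this
  · rw [hlen]
    exact_mod_cast Nat.lt_succ_self k

end Hops

end Heartbeat

/-! ### The effect of one receipt. -/

namespace Heartbeat

variable {V : Type*} {G : SimpleGraph V} {ok : V → Prop} {k : ℕ} {r p q : V} {c : ℤ}
  {m : Message V} {s s' : LocalState V}

theorem paths_subset_processNode (u : V) : s.paths u ⊆ (processNode p m s r).paths u := by
  unfold processNode
  dsimp only
  split_ifs with h
  · subst h
    exact Set.subset_union_left
  · exact subset_rfl

theorem paths_subset_foldl (order : List V) (u : V) :
    s.paths u ⊆ (order.foldl (processNode p m) s).paths u :=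
  List.foldlRecOn (motive := fun t : LocalState V => s.paths u ⊆ t.paths u) order _ subset_rfl
    fun _ ht _ _ => ht.trans (paths_subset_processNode u)

theorem append_mem_paths_foldl {order : List V} (hr : r ∈ order) {ρ : List V}
    (hρ : ρ ∈ m.pathSets r) (hp : p ∉ ρ) :
    ρ ++ [p] ∈ (order.foldl (processNode p m) s).paths r := by
  obtain ⟨l₁, l₂, rfl⟩ := List.append_of_mem hr
  rw [List.foldl_append, List.foldl_cons]
  refine paths_subset_foldl l₂ r ?_
  unfold processNode
  dsimp only
  rw [if_pos rfl]
  exact .inr ⟨ρ, hρ, hp, rfl⟩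

theorem isSimplePath_processNode (hadj : G.Adj q p)
    (hm : ∀ r, ∀ π ∈ m.pathSets r, IsSimplePath G r q π)
    (hs : ∀ r, ∀ π ∈ s.paths r, IsSimplePath G r p π) (u : V) :
    ∀ π ∈ (processNode p m s r).paths u, IsSimplePath G u p π := by
  intro π hπ
  unfold processNode at hπ
  dsimp only at hπ
  split_ifs at hπ with h
  · subst h
    rcases hπ with hπ | ⟨ρ, hρ, hp, rfl⟩
    · exact hs _ _ hπ
    · exact (hm _ _ hρ).concat hadj hp
  · exact hs _ _ hπ

theorem isSimplePath_foldl (hadj : G.Adj q p)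
    (hm : ∀ r, ∀ π ∈ m.pathSets r, IsSimplePath G r q π)
    (hs : ∀ r, ∀ π ∈ s.paths r, IsSimplePath G r p π) (order : List V) :
    ∀ u, ∀ π ∈ (order.foldl (processNode p m) s).paths u, IsSimplePath G u p π :=
  List.foldlRecOn (motive := fun t : LocalState V => ∀ u, ∀ π ∈ t.paths u,
    IsSimplePath G u p π) order _ hs fun _ ht _ _ => isSimplePath_processNode hadj hm ht

theorem suspectLocal_processNode_of_ne {u : V} (h : u ≠ r) :
    (processNode p m s r).suspectLocal u = s.suspectLocal u := by
  simp [processNode, h]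

theorem suspectLocal_foldl_of_not_mem {u : V} {order : List V} (h : u ∉ order) :
    (order.foldl (processNode p m) s).suspectLocal u = s.suspectLocal u :=
  List.foldlRecOn (motive := fun t : LocalState V => t.suspectLocal u = s.suspectLocal u) order
    _ rfl fun _ ht _ hr =>
      (suspectLocal_processNode_of_ne (ne_of_mem_of_not_mem hr h).symm).trans ht

/-- The loop does visit `p`, but paths recorded for `p` start with `p`, so `h' = ∞` and nothing is
copied. -/
theorem suspectLocal_processNode_self (hm : ∀ π ∈ m.pathSets p, IsSimplePath G p q π) :
    (processNode p m s r).suspectLocal p = s.suspectLocal p := by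
  unfold processNode
  dsimp only
  rw [if_neg]
  rintro ⟨rfl, h⟩
  obtain ⟨π, ⟨hπ, hp, -⟩, -⟩ := shortestLength_lt_iff.1 h
  exact hp (List.mem_of_mem_head? (hm π hπ).1)

theorem suspectLocal_foldl_self (hm : ∀ π ∈ m.pathSets p, IsSimplePath G p q π)
    (order : List V) :
    (order.foldl (processNode p m) s).suspectLocal p = s.suspectLocal p :=
  List.foldlRecOn (motive := fun t : LocalState V => t.suspectLocal p = s.suspectLocal p) order
    _ rfl fun _ ht _ _ => (suspectLocal_processNode_self hm).trans ht

theorem foldl_processNode_fields (order : List V) :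
    (order.foldl (processNode p m) s).crashed = s.crashed ∧
    (order.foldl (processNode p m) s).lastContact = s.lastContact ∧
    (order.foldl (processNode p m) s).timeout = s.timeout :=
  List.foldlRecOn (motive := fun t : LocalState V => t.crashed = s.crashed ∧
    t.lastContact = s.lastContact ∧ t.timeout = s.timeout) order _ ⟨rfl, rfl, rfl⟩
    fun _ ht _ _ => ht

/-- The processing of a node at distance `k` does not spoil its flag. -/
theorem suspectLocal_processNode_iff {u : V} (hs : Accurate G ok k p s.suspectLocal)
    (hm : Accurate G ok k q m.suspectRcv) (hmv : ∀ π ∈ m.pathSets u, IsSimplePath G u q π)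
    (hpath : HasGoodPath G ok k u p (s.paths u)) (hu : s.suspectLocal u = true ↔ ¬ ok u) :
    (processNode p m s r).suspectLocal u = true ↔ ¬ ok u := by
  unfold processNode
  dsimp only
  split_ifs with h
  · obtain ⟨rfl, h⟩ := h
    exact suspectRcv_iff_of_hopFromMsg_lt hm hmv (h.trans_le (hop_le hs hpath))
  · exact hu

/-- Each node is treated at its own distance `i < k`, with accuracy weakened to `i`. -/
theorem Accurate.processNode (hs : Accurate G ok k p s.suspectLocal)
    (hm : Accurate G ok k q m.suspectRcv)
    (hmv : ∀ r, ∀ π ∈ m.pathSets r, IsSimplePath G r q π)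
    (hpath : ∀ j < k, ∀ u, IsDist G ok j u p → HasGoodPath G ok j u p (s.paths u)) :
    Accurate G ok k p (processNode p m s r).suspectLocal := by
  intro j hj u hr
  obtain ⟨i, hi, hdist⟩ := hr.exists_isDist
  exact suspectLocal_processNode_iff (hs.mono (by omega)) (hm.mono (by omega)) (hmv u)
    (hpath i (by omega) u hdist) (hs j hj u hr)

theorem suspectLocal_processNode_iff_of_lt (hs : Accurate G ok k p s.suspectLocal)
    (hm : Accurate G ok k q m.suspectRcv) (hmv : ∀ π ∈ m.pathSets r, IsSimplePath G r q π)
    (hsv : ∀ π ∈ s.paths r, IsSimplePath G r p π) (hdist : IsDist G ok k r p)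
    (hlt : hopFromMsg p m r < k) :
    (processNode p m s r).suspectLocal r = true ↔ ¬ ok r := by
  unfold processNode
  dsimp only
  rw [if_pos ⟨rfl, hlt.trans_le (le_hop hs hsv hdist)⟩]
  exact suspectRcv_iff_of_hopFromMsg_lt hm hmv hlt

theorem Accurate.foldl (hs : Accurate G ok k p s.suspectLocal)
    (hm : Accurate G ok k q m.suspectRcv)
    (hmv : ∀ r, ∀ π ∈ m.pathSets r, IsSimplePath G r q π)
    (hpath : ∀ j < k, ∀ u, IsDist G ok j u p → HasGoodPath G ok j u p (s.paths u))
    (order : List V) :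
    Accurate G ok k p (order.foldl (Heartbeat.processNode p m) s).suspectLocal :=
  (List.foldlRecOn (motive := fun t : LocalState V => Accurate G ok k p t.suspectLocal ∧
      ∀ u, s.paths u ⊆ t.paths u) order _ ⟨hs, fun _ => subset_rfl⟩ fun _ ht _ _ =>
    ⟨ht.1.processNode hm hmv fun j hj u hd => (hpath j hj u hd).mono (ht.2 u),
      fun u => (ht.2 u).trans (paths_subset_processNode u)⟩).1

/-- Since `h` is read from the current state in each iteration, accuracy and the growth of the path
sets are part of the loop invariant. -/
theorem suspectLocal_foldl_iff {u : V} (hs : Accurate G ok k p s.suspectLocal)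
    (hm : Accurate G ok k q m.suspectRcv)
    (hmv : ∀ r, ∀ π ∈ m.pathSets r, IsSimplePath G r q π)
    (hpath : ∀ j < k, ∀ u, IsDist G ok j u p → HasGoodPath G ok j u p (s.paths u))
    (hpu : HasGoodPath G ok k u p (s.paths u)) (hu : s.suspectLocal u = true ↔ ¬ ok u)
    (order : List V) :
    (order.foldl (Heartbeat.processNode p m) s).suspectLocal u = true ↔ ¬ ok u :=
  (List.foldlRecOn (motive := fun t : LocalState V => (t.suspectLocal u = true ↔ ¬ ok u) ∧
      Accurate G ok k p t.suspectLocal ∧ ∀ u, s.paths u ⊆ t.paths u) order _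
    ⟨hu, hs, fun _ => subset_rfl⟩ fun _ ht _ _ =>
    ⟨suspectLocal_processNode_iff ht.2.1 hm (hmv u) (hpu.mono (ht.2.2 u)) ht.1,
      ht.2.1.processNode hm hmv fun j hj u hd => (hpath j hj u hd).mono (ht.2.2 u),
      fun u => (ht.2.2 u).trans (paths_subset_processNode u)⟩).1

/-- The turn of `r` is isolated: earlier turns keep the flags accurate, this turn copies the
sender's flag because `h' < k ≤ h`, and later turns cannot spoil it. -/
theorem suspectLocal_foldl_iff_of_lt (hadj : G.Adj q p)
    (hs : Accurate G ok k p s.suspectLocal)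
    (hsv : ∀ r, ∀ π ∈ s.paths r, IsSimplePath G r p π)
    (hm : Accurate G ok k q m.suspectRcv)
    (hmv : ∀ r, ∀ π ∈ m.pathSets r, IsSimplePath G r q π)
    (hpath : ∀ j < k, ∀ u, IsDist G ok j u p → HasGoodPath G ok j u p (s.paths u))
    (hpr : HasGoodPath G ok k r p (s.paths r)) (hdist : IsDist G ok k r p)
    (hlt : hopFromMsg p m r < k) {order : List V} (hr : r ∈ order) :
    (order.foldl (Heartbeat.processNode p m) s).suspectLocal r = true ↔ ¬ ok r := by
  obtain ⟨l₁, l₂, rfl⟩ := List.append_of_mem hr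
  rw [List.foldl_append, List.foldl_cons]
  have h1 := hs.foldl hm hmv hpath l₁
  have hp1 : ∀ u, s.paths u ⊆ _ := paths_subset_foldl (p := p) (m := m) l₁
  have hv1 := isSimplePath_foldl hadj hmv hsv l₁
  set t := l₁.foldl (Heartbeat.processNode p m) s
  have hpath1 : ∀ j < k, ∀ u, IsDist G ok j u p → HasGoodPath G ok j u p (t.paths u) :=
    fun j hj u hd => (hpath j hj u hd).mono (hp1 u)
  refine suspectLocal_foldl_iff (h1.processNode hm hmv hpath1) hm hmv
    (fun j hj u hd => (hpath1 j hj u hd).mono (paths_subset_processNode u))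
    ((hpr.mono (hp1 r)).mono (paths_subset_processNode r)) ?_ l₂
  exact suspectLocal_processNode_iff_of_lt h1 hm (hmv r) (hv1 r) hdist hlt

/-- Clearing the sender's flag is harmless because the sender satisfies `ok`. -/
theorem Accurate.recordContact (hs : Accurate G ok k p s.suspectLocal) (hq : ok q) :
    Accurate G ok k p (recordContact c q s).suspectLocal := by
  intro j hj u hr
  unfold Heartbeat.recordContact
  dsimp only
  split_ifs with h
  · simp [h, hq]
  · exact hs j hj u hr

namespace ReceiveEffect

theorem crashed_eq (h : ReceiveEffect G p q c m s s') : s'.crashed = s.crashed := by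
  obtain ⟨order, -, -, rfl⟩ := h
  exact (foldl_processNode_fields order).1

open Classical in
theorem lastContact_eq (h : ReceiveEffect G p q c m s s') (u : V) :
    s'.lastContact u = if u = q then c else s.lastContact u := by
  obtain ⟨order, -, -, rfl⟩ := h
  exact congrFun (foldl_processNode_fields order).2.1 u

open Classical in
theorem timeout_eq (h : ReceiveEffect G p q c m s s') (u : V) :
    s'.timeout u = if u = q ∧ s.suspectLocal q = true then 2 * (c - s.lastContact q)
      else s.timeout u := by
  obtain ⟨order, -, -, rfl⟩ := h
  exact congrFun (foldl_processNode_fields order).2.2 u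

open Classical in
theorem suspectLocal_of_adj (h : ReceiveEffect G p q c m s s') {u : V} (hu : G.Adj p u) :
    s'.suspectLocal u = if u = q then false else s.suspectLocal u := by
  obtain ⟨order, -, ho, rfl⟩ := h
  have hu' : u ∉ order := fun h => (ho u).1 h hu
  exact suspectLocal_foldl_of_not_mem hu'

theorem paths_subset (h : ReceiveEffect G p q c m s s') (u : V) : s.paths u ⊆ s'.paths u := by
  obtain ⟨order, -, -, rfl⟩ := h
  exact paths_subset_foldl (s := Heartbeat.recordContact c q s) order u

theorem append_mem_paths (h : ReceiveEffect G p q c m s s') (hr : ¬ G.Adj p r) {ρ : List V}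
    (hρ : ρ ∈ m.pathSets r) (hp : p ∉ ρ) : ρ ++ [p] ∈ s'.paths r := by
  obtain ⟨order, -, ho, rfl⟩ := h
  exact append_mem_paths_foldl ((ho r).2 hr) hρ hp

theorem isSimplePath (h : ReceiveEffect G p q c m s s') (hadj : G.Adj q p)
    (hm : ∀ r, ∀ π ∈ m.pathSets r, IsSimplePath G r q π)
    (hs : ∀ r, ∀ π ∈ s.paths r, IsSimplePath G r p π) :
    ∀ r, ∀ π ∈ s'.paths r, IsSimplePath G r p π := by
  obtain ⟨order, -, -, rfl⟩ := h
  exact isSimplePath_foldl (s := Heartbeat.recordContact c q s) hadj hm hs order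

theorem suspectLocal_self (h : ReceiveEffect G p q c m s s') (hadj : G.Adj q p)
    (hm : ∀ r, ∀ π ∈ m.pathSets r, IsSimplePath G r q π) :
    s'.suspectLocal p = s.suspectLocal p := by
  obtain ⟨order, -, -, rfl⟩ := h
  refine (suspectLocal_foldl_self (hm p) order).trans ?_
  simp [Heartbeat.recordContact, hadj.ne']

theorem suspect_eq_false (h : ReceiveEffect G p q c m s s') {π : List V} (hπ : π ∈ s'.paths r)
    (hr : s'.suspectLocal r = false) (hu : ∀ u ∈ π, u ≠ r → s'.suspectLocal u = false) :
    s'.suspect r = false := by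
  obtain ⟨order, -, -, rfl⟩ := h
  have : ¬ (¬ G.Adj p r ∧ ∀ π ∈ (order.foldl (processNode p m) (recordContact c q s)).paths r,
      ∃ u ∈ π, u ≠ r ∧
        (order.foldl (processNode p m) (recordContact c q s)).suspectLocal u = true) := by
    rintro ⟨-, h⟩
    obtain ⟨u, h1, h2, h3⟩ := h π hπ
    have h4 : (order.foldl (processNode p m) (recordContact c q s)).suspectLocal u = false :=
      hu u h1 h2
    rw [h4] at h3
    cases h3
  unfold deriveSuspect
  dsimp only
  rw [if_neg this]
  exact hr

theorem suspectLocal_iff (h : ReceiveEffect G p q c m s s') (hadj : G.Adj q p) (hq : ok q)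
    (hs : Accurate G ok k p s.suspectLocal) (hm : Accurate G ok k q m.suspectRcv)
    (hmv : ∀ r, ∀ π ∈ m.pathSets r, IsSimplePath G r q π)
    (hpath : ∀ j < k, ∀ u, IsDist G ok j u p → HasGoodPath G ok j u p (s.paths u))
    (hpr : HasGoodPath G ok k r p (s.paths r)) (hr : ¬ G.Adj p r)
    (hsr : s.suspectLocal r = true ↔ ¬ ok r) : s'.suspectLocal r = true ↔ ¬ ok r := by
  obtain ⟨order, -, -, rfl⟩ := h
  refine suspectLocal_foldl_iff (s := Heartbeat.recordContact c q s) (hs.recordContact hq) hm hmv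
    hpath hpr ?_ order
  have hne : r ≠ q := fun h => hr (h ▸ hadj.symm)
  simpa [Heartbeat.recordContact, hne] using hsr

theorem suspectLocal_iff_of_lt (h : ReceiveEffect G p q c m s s') (hadj : G.Adj q p) (hq : ok q)
    (hs : Accurate G ok k p s.suspectLocal)
    (hsv : ∀ r, ∀ π ∈ s.paths r, IsSimplePath G r p π)
    (hm : Accurate G ok k q m.suspectRcv)
    (hmv : ∀ r, ∀ π ∈ m.pathSets r, IsSimplePath G r q π)
    (hpath : ∀ j < k, ∀ u, IsDist G ok j u p → HasGoodPath G ok j u p (s.paths u))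
    (hpr : HasGoodPath G ok k r p (s.paths r)) (hdist : IsDist G ok k r p)
    (hlt : hopFromMsg p m r < k) (hr : ¬ G.Adj p r) : s'.suspectLocal r = true ↔ ¬ ok r := by
  obtain ⟨order, -, ho, rfl⟩ := h
  exact suspectLocal_foldl_iff_of_lt (s := Heartbeat.recordContact c q s) hadj
    (hs.recordContact hq) hsv hm hmv hpath hpr hdist hlt ((ho r).2 hr)

end ReceiveEffect

end Heartbeat

/-! ### Executions: clocks, message arrival and ADD channels. -/

namespace Heartbeat

theorem Network.clock_mono {V : Type*} (N : Network V) (p : V) : Monotone (N.clock p) := by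
  intro s t hst
  have := N.rate_pos p
  exact Int.floor_le_floor (by gcongr)

namespace Execution

variable {V : Type*} {N : Network V} (X : Execution N) {p q : V} {n i : ℕ}

theorem correct_iff : X.Correct p ↔ ∀ n, X.event n ≠ .crash p :=
  ⟨fun h n hn => h (X.time n) ⟨n, hn, le_rfl⟩, fun h _ ⟨n, hn, _⟩ => h n hn⟩

theorem clock_time_mono (p : V) : Monotone fun n => N.clock p (X.time n) :=
  (N.clock_mono p).comp X.time_mono

theorem lt_of_clock_lt (p : V) {m n : ℕ}
    (h : N.clock p (X.time m) < N.clock p (X.time n)) : m < n := by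
  by_contra! hle
  exact absurd (X.clock_time_mono p hle) (not_le.2 h)

theorem lt_of_time_lt {m n : ℕ} (h : X.time m < X.time n) : m < n := by
  by_contra! hle
  exact absurd (X.time_mono hle) (not_le.2 h)

theorem receive_spec (h : X.event n = .receive i p) :
    (X.state n p).crashed = false ∧ i < n ∧ ∃ q, X.event i = .heartbeat q ∧ N.graph.Adj q p ∧
      ReceiveEffect N.graph p q (N.clock p (X.time n)) (X.state i q).message (X.state n p)
        (X.state (n + 1) p) := by
  have hs := X.isStep n
  rw [IsStep, h] at hs
  obtain ⟨hc, q, hi, hq, hadj, s', hs', hst⟩ := hs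
  refine ⟨hc, hi, q, hq, hadj, ?_⟩
  rw [hst]
  simpa using hs'

theorem receiveEffect (h : X.event n = .receive i p) (hq : X.event i = .heartbeat q) :
    ReceiveEffect N.graph p q (N.clock p (X.time n)) (X.state i q).message (X.state n p)
      (X.state (n + 1) p) := by
  obtain ⟨-, -, q', hq', -, he⟩ := X.receive_spec h
  rw [hq] at hq'
  cases hq'
  exact he

/-- What an event does to the variables of `p`. -/
theorem step_cases (n : ℕ) (p : V) :
    X.state (n + 1) p = X.state n p ∨
    (X.event n = .crash p ∧ X.state (n + 1) p = { X.state n p with crashed := true }) ∨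
    (∃ i q, X.event n = .receive i p ∧ X.event i = .heartbeat q ∧ N.graph.Adj q p ∧ i < n ∧
      ReceiveEffect N.graph p q (N.clock p (X.time n)) (X.state i q).message (X.state n p)
        (X.state (n + 1) p)) ∨
    (∃ q, N.graph.Adj p q ∧
      (X.state n p).timeout q = N.clock p (X.time n) - (X.state n p).lastContact q ∧
      X.state (n + 1) p = expireEffect q (X.state n p)) := by
  have hs := X.isStep n
  rw [IsStep] at hs
  cases he : X.event n with
  | idle =>
    rw [he] at hs
    exact .inl (congrFun hs p)
  | crash p' =>
    rw [he] at hs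
    rw [hs.2]
    by_cases h : p = p'
    · subst h
      exact .inr (.inl ⟨rfl, by simp⟩)
    · exact .inl (by simp [h])
  | heartbeat p' =>
    rw [he] at hs
    exact .inl (congrFun hs.2.2 p)
  | receive i p' =>
    by_cases h : p = p'
    · subst h
      obtain ⟨-, hi, q, hq, hadj, heff⟩ := X.receive_spec he
      exact .inr (.inr (.inl ⟨i, q, rfl, hq, hadj, hi, heff⟩))
    · rw [he] at hs
      obtain ⟨-, q, -, -, -, s', -, hst⟩ := hs
      exact .inl (by rw [hst]; simp [h])
  | expire p' q =>
    rw [he] at hs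
    obtain ⟨-, hadj, ht, hst⟩ := hs
    rw [hst]
    by_cases h : p = p'
    · subst h
      exact .inr (.inr (.inr ⟨q, hadj, ht, by simp⟩))
    · exact .inl (by simp [h])

theorem crashed_eq_false (hp : X.Correct p) (n : ℕ) : (X.state n p).crashed = false := by
  induction n with
  | zero => rw [X.state_zero]; rfl
  | succ n ih =>
    rcases X.step_cases n p with h | ⟨h, -⟩ | ⟨_, _, -, -, -, -, h⟩ | ⟨_, -, -, h⟩
    · rw [h, ih]
    · exact absurd h (X.correct_iff.1 hp n)
    · rw [h.crashed_eq, ih]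
    · rw [h]; exact ih

theorem crashed_eq_true {k : ℕ} (h : X.event k = .crash p) (hkn : k < n) :
    (X.state n p).crashed = true := by
  induction n, hkn using Nat.le_induction with
  | base =>
    have hs := X.isStep k
    rw [IsStep, h] at hs
    simp [hs.2]
  | succ n _ ih =>
    rcases X.step_cases n p with h | ⟨-, h⟩ | ⟨_, _, -, -, -, -, h⟩ | ⟨_, -, -, h⟩
    · rw [h, ih]
    · rw [h]
    · rw [h.crashed_eq, ih]
    · rw [h]; exact ih

theorem crashed_of_heartbeat (h : X.event n = .heartbeat p) : (X.state n p).crashed = false := by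
  have hs := X.isStep n
  rw [IsStep, h] at hs
  exact hs.1

open Filter

/-- Old messages eventually stop arriving. -/
theorem eventually_receive_ge (p : V) (M : ℕ) :
    ∀ᶠ n in atTop, ∀ i, X.event n = .receive i p → M ≤ i := by
  have h : ∀ i ∈ Set.Iio M, ∀ᶠ n in atTop, X.event n ≠ .receive i p := by
    intro i _
    by_cases hex : ∃ m, X.event m = .receive i p
    · obtain ⟨m, hm⟩ := hex
      filter_upwards [eventually_gt_atTop m] with n hn hn'
      exact hn.ne (X.no_duplicates i p m n hm hn')
    · exact .of_forall fun n hn => hex ⟨n, hn⟩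
  filter_upwards [(Set.finite_Iio M).eventually_all.2 h] with n hn i hi
  by_contra! hlt
  exact hn i hlt hi

/-- Messages that satisfy a condition eventually satisfied at their sender are the only ones to
arrive eventually. -/
theorem eventually_receive (p : V) {P : ℕ → Prop} (h : ∀ᶠ i in atTop, P i) :
    ∀ᶠ n in atTop, ∀ i, X.event n = .receive i p → P i := by
  obtain ⟨M, hM⟩ := eventually_atTop.1 h
  filter_upwards [X.eventually_receive_ge p M] with n hn i hi
  exact hM i (hn i hi)

/-- A crashed node sends nothing after its crash, and there are finitely many nodes. -/
theorem eventually_heartbeat_correct [Finite V] :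
    ∀ᶠ n in atTop, ∀ q, X.event n = .heartbeat q → X.Correct q := by
  rw [eventually_all]
  intro q
  by_cases hq : X.Correct q
  · exact .of_forall fun _ _ => hq
  · rw [correct_iff] at hq
    push Not at hq
    obtain ⟨k, hk⟩ := hq
    filter_upwards [eventually_gt_atTop k] with n hn he
    have h1 := X.crashed_of_heartbeat he
    rw [X.crashed_eq_true hk hn] at h1
    cases h1

theorem eventually_clock_gt (p : V) (c : ℤ) : ∀ᶠ n in atTop, c < N.clock p (X.time n) := by
  have h : Tendsto (fun n => N.rate p * X.time n + N.offset p) atTop atTop :=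
    tendsto_atTop_add_const_right _ _ (X.time_diverges.const_mul_atTop (N.rate_pos p))
  filter_upwards [h.eventually_ge_atTop ((c + 1 : ℤ) : ℝ)] with n hn
  exact Int.lt_iff_add_one_le.2 (Int.le_floor.2 hn)

/-- On a channel between correct nodes, messages arrive at bounded intervals. -/
theorem exists_receive_within (hadj : N.graph.Adj q p) (hq : X.Correct q) (hp : X.Correct p) :
    ∃ t₀ B : ℝ, ∀ t ≥ t₀, ∃ i n, X.event i = .heartbeat q ∧ X.event n = .receive i p ∧
      t ≤ X.time i ∧ X.time n ≤ t + B := by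
  obtain ⟨privileged, d, r, hpriv, hrun⟩ := X.channels q p hadj
  have hrate := N.rate_pos q
  have hT : (0 : ℤ) < N.period q := by exact_mod_cast N.period_pos q
  -- Heartbeats are guaranteed only for nonnegative multiples of the period not below the initial
  -- reading.
  obtain ⟨n₀, hn₀⟩ := (X.eventually_clock_gt q (max 0 (N.clock q 0))).exists
  -- The clock of `q` needs at most `r + 1` periods to show the `r + 1` multiples following its
  -- reading at `t`; the added 1 covers rounding, and `d` the delivery.
  refine ⟨X.time n₀, ((N.period q : ℝ) * (r + 1) + 1) / N.rate q + d, fun t ht => ?_⟩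
  have hct := hn₀.trans_le (N.clock_mono q ht)
  set c := N.clock q t with hc
  have hc0 : 0 < c := (le_max_left _ _).trans_lt hct
  -- The first multiple of the period strictly above `c`, so that the heartbeat is sent after `t`.
  set k₀ : ℕ := (c / N.period q + 1).toNat with hk₀
  have hk₀' : (k₀ : ℤ) = c / N.period q + 1 := by
    have : 0 ≤ c / N.period q := Int.ediv_nonneg hc0.le hT.le
    omega
  have hlow : c < k₀ * N.period q := by
    rw [hk₀']
    exact Int.lt_ediv_add_one_mul_self c hT
  have hup : (k₀ : ℤ) * N.period q ≤ c + N.period q := by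
    rw [hk₀', add_mul, one_mul]
    have := Int.ediv_mul_le c hT.ne'
    omega
  have hsend : ∀ j : ℕ, ∃ n, X.event n = .heartbeat q ∧
      N.clock q (X.time n) = (k₀ + j : ℕ) * N.period q := by
    intro j
    have hle : N.clock q 0 ≤ (k₀ + j : ℕ) * N.period q := by
      have h1 : N.clock q 0 < c := (le_max_right _ _).trans_lt hct
      push_cast
      nlinarith
    rcases X.heartbeat_taken q (k₀ + j) hle with h | ⟨n, hn, -⟩
    · exact h
    · exact absurd hn (X.correct_iff.1 hq n)
  choose a ha hca using hsend
  have hmono : StrictMono a := by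
    intro j j' hjj
    apply X.lt_of_clock_lt q
    rw [hca, hca]
    have : ((k₀ + j : ℕ) : ℤ) < (k₀ + j' : ℕ) := by exact_mod_cast Nat.add_lt_add_left hjj _
    exact mul_lt_mul_of_pos_right this hT
  -- A run without a privileged message has at most `r` members, but `a 0, …, a r` are `r + 1`
  -- heartbeats.
  have hex : ∃ i, a 0 ≤ i ∧ i < a r + 1 ∧ X.event i = .heartbeat q ∧ i ∈ privileged := by
    by_contra! hno
    have hle := hrun (a 0) (a r + 1) hno
    have hfin : {m | a 0 ≤ m ∧ m < a r + 1 ∧ X.event m = .heartbeat q}.Finite :=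
      (Set.finite_Iio (a r + 1)).subset fun m hm => hm.2.1
    have hsub : a '' Set.Iic r ⊆ {m | a 0 ≤ m ∧ m < a r + 1 ∧ X.event m = .heartbeat q} := by
      rintro _ ⟨j, hj, rfl⟩
      exact ⟨hmono.monotone (Nat.zero_le j), Nat.lt_succ_of_le (hmono.monotone hj), ha j⟩
    have h1 := Set.ncard_le_ncard hsub hfin
    rw [Set.ncard_image_of_injective _ hmono.injective] at h1
    have h2 : (Set.Iic r).ncard = r + 1 := by
      rw [Set.ncard_eq_toFinset_card']
      simp
    omega
  obtain ⟨i, hi0, hir, hev, hip⟩ := hex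
  rcases hpriv i hip hev with ⟨n, hn, htn⟩ | ⟨n, hn, -⟩
  · refine ⟨i, n, hev, hn, ?_, ?_⟩
    · refine le_trans ?_ (X.time_mono hi0)
      by_contra! hlt
      have h1 := N.clock_mono q hlt.le
      rw [hca] at h1
      push_cast at h1
      rw [← hc] at h1
      linarith
    · have h1 : X.time i ≤ X.time (a r) := X.time_mono (by omega)
      have h2 : N.rate q * X.time (a r) + N.offset q < (k₀ + r : ℕ) * N.period q + 1 := by
        have h3 := Int.lt_floor_add_one (N.rate q * X.time (a r) + N.offset q)
        have h4 : ⌊N.rate q * X.time (a r) + N.offset q⌋ = (k₀ + r : ℕ) * N.period q := hca r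
        rw [h4] at h3
        exact_mod_cast h3
      have h5 : (c : ℝ) ≤ N.rate q * t + N.offset q := Int.floor_le _
      have h6 : (k₀ : ℝ) * N.period q ≤ c + N.period q := by exact_mod_cast hup
      have h7 : X.time (a r) ≤ t + ((N.period q : ℝ) * (r + 1) + 1) / N.rate q := by
        rw [← sub_le_iff_le_add', le_div_iff₀ hrate]
        push_cast at h2
        nlinarith
      linarith
  · exact absurd hn (X.correct_iff.1 hp n)

theorem exists_receive_ge (hadj : N.graph.Adj q p) (hq : X.Correct q) (hp : X.Correct p)
    (M : ℕ) : ∃ n ≥ M, ∃ i, X.event i = .heartbeat q ∧ X.event n = .receive i p := by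
  obtain ⟨t₀, B, h⟩ := X.exists_receive_within hadj hq hp
  obtain ⟨i, n, hi, hn, hti, -⟩ := h (max t₀ (X.time M + 1)) (le_max_left _ _)
  have h1 : X.time M + 1 ≤ X.time i := (le_max_right _ _).trans hti
  have h2 : M < i := X.lt_of_time_lt (by linarith)
  exact ⟨n, (h2.trans (X.receive_spec hn).2.1).le, i, hi, hn⟩

/-! ### Timers and flags of neighbors. -/

/-- The event `n` is not the receipt at `p` of a message from `q`. -/
def NoContact (n : ℕ) (q p : V) : Prop :=
  ∀ i, X.event n = .receive i p → X.event i ≠ .heartbeat q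

open Classical in
/-- What an event does to the timer for a neighbor. -/
theorem timer_cases (hadj : N.graph.Adj p q) (n : ℕ) :
    ((X.state (n + 1) p).lastContact q = (X.state n p).lastContact q ∧
      (X.state (n + 1) p).timeout q = (X.state n p).timeout q ∧
      ((X.state (n + 1) p).suspectLocal q = (X.state n p).suspectLocal q ∨
        (X.state (n + 1) p).suspectLocal q = true ∧
        (X.state n p).timeout q = N.clock p (X.time n) - (X.state n p).lastContact q)) ∨
    (¬ X.NoContact n q p ∧ (X.state (n + 1) p).lastContact q = N.clock p (X.time n) ∧
      (X.state (n + 1) p).suspectLocal q = false ∧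
      (X.state (n + 1) p).timeout q = if (X.state n p).suspectLocal q = true then
        2 * (N.clock p (X.time n) - (X.state n p).lastContact q)
        else (X.state n p).timeout q) := by
  rcases X.step_cases n p with h | ⟨-, h⟩ | ⟨i, q', hn, hi, -, -, h⟩ | ⟨q', -, ht, h⟩
  · simp [h]
  · simp [h]
  · by_cases hq : q = q'
    · subst hq
      refine .inr ⟨fun h' => h' i hn hi, ?_, ?_, ?_⟩
      · rw [h.lastContact_eq, if_pos rfl]
      · rw [h.suspectLocal_of_adj hadj, if_pos rfl]
      · rw [h.timeout_eq]
        simp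
    · refine .inl ⟨?_, ?_, .inl ?_⟩
      · rw [h.lastContact_eq, if_neg hq]
      · rw [h.timeout_eq, if_neg fun h => hq h.1]
      · rw [h.suspectLocal_of_adj hadj, if_neg hq]
  · rw [h]
    refine .inl ⟨rfl, rfl, ?_⟩
    by_cases hq : q = q'
    · subst hq
      exact .inr ⟨by simp [expireEffect], ht⟩
    · exact .inl (by simp [expireEffect, hq])

theorem timer_of_receive (hadj : N.graph.Adj p q) (hn : X.event n = .receive i p)
    (hi : X.event i = .heartbeat q) :
    (X.state (n + 1) p).lastContact q = N.clock p (X.time n) ∧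
      (X.state (n + 1) p).suspectLocal q = false ∧
      ((X.state n p).suspectLocal q = true → (X.state (n + 1) p).timeout q =
        2 * (N.clock p (X.time n) - (X.state n p).lastContact q)) := by
  have h := X.receiveEffect hn hi
  refine ⟨?_, ?_, fun hs => ?_⟩
  · rw [h.lastContact_eq, if_pos rfl]
  · rw [h.suspectLocal_of_adj hadj, if_pos rfl]
  · rw [h.timeout_eq, if_pos ⟨rfl, hs⟩]

/-- A crashed neighbor is eventually suspected permanently. -/
theorem eventually_suspectLocal_of_not_correct [Finite V] (hadj : N.graph.Adj p q)
    (hp : X.Correct p) (hq : ¬ X.Correct q) :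
    ∀ᶠ n in atTop, (X.state n p).suspectLocal q = true := by
  have h := X.eventually_receive p X.eventually_heartbeat_correct
  obtain ⟨M, hM⟩ := eventually_atTop.1 h
  have hno : ∀ n ≥ M, X.NoContact n q p := fun n hn i h1 h2 => hq (hM n hn i h1 q h2)
  have hstep : ∀ n ≥ M, (X.state n p).lastContact q = (X.state M p).lastContact q ∧
      (X.state n p).timeout q = (X.state M p).timeout q := by
    intro n hn
    induction n, hn using Nat.le_induction with
    | base => exact ⟨rfl, rfl⟩
    | succ n hn ih =>
      rcases X.timer_cases hadj n with h | h
      · rw [h.1, h.2.1]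
        exact ih
      · exact absurd (hno n hn) h.1
  -- With `lastContact` and `timeout` frozen, the clock passes the due value, which `expiry_taken`
  -- allows only if `q` is flagged.
  filter_upwards [X.eventually_clock_gt p
    ((X.state M p).lastContact q + (X.state M p).timeout q), eventually_ge_atTop M] with n hc hn
  by_contra hs
  have := X.expiry_taken n p q (X.crashed_eq_false hp n) hadj (by simpa using hs)
  rw [(hstep n hn).1, (hstep n hn).2] at this
  omega

/-- A flag is raised when the silence equals the timeout; thereafter the silence does not shrink
until a contact clears the flag. Positivity makes doubling a real increase. -/
theorem timer_invariant (hadj : N.graph.Adj p q) (n : ℕ) :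
    0 < (X.state n p).timeout q ∧ ((X.state n p).suspectLocal q = true →
      (X.state n p).timeout q ≤ N.clock p (X.time n) - (X.state n p).lastContact q) := by
  induction n with
  | zero =>
    rw [X.state_zero]
    simpa [initialState] using N.period_pos p
  | succ n ih =>
    have hc : N.clock p (X.time n) ≤ N.clock p (X.time (n + 1)) := X.clock_time_mono p n.le_succ
    rcases X.timer_cases hadj n with ⟨h1, h2, h3⟩ | ⟨-, h1, h2, h3⟩
    · rw [h1, h2]
      refine ⟨ih.1, fun hs => ?_⟩
      rcases h3 with h3 | ⟨-, h3⟩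
      · have := ih.2 (h3 ▸ hs)
        omega
      · omega
    · rw [h2, h3]
      refine ⟨?_, by simp⟩
      split_ifs with hs
      · have := ih.2 hs
        omega
      · exact ih.1

theorem timeout_mono (hadj : N.graph.Adj p q) : Monotone fun n => (X.state n p).timeout q := by
  refine monotone_nat_of_le_succ fun n => ?_
  rcases X.timer_cases hadj n with ⟨-, h2, -⟩ | ⟨-, -, -, h3⟩
  · rw [h2]
  · rw [h3]
    obtain ⟨h4, h5⟩ := X.timer_invariant hadj n
    split_ifs with hs
    · have := h5 hs
      omega
    · exact le_rfl

theorem le_lastContact (hadj : N.graph.Adj p q) {m : ℕ} {i : ℕ}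
    (hm : X.event m = .receive i p) (hi : X.event i = .heartbeat q) (hmn : m < n) :
    N.clock p (X.time m) ≤ (X.state n p).lastContact q := by
  induction n, hmn using Nat.le_induction with
  | base => exact (X.timer_of_receive hadj hm hi).1.ge
  | succ n hn ih =>
    rcases X.timer_cases hadj n with ⟨h1, -, -⟩ | ⟨-, h1, -⟩
    · rwa [h1]
    · rw [h1]
      exact X.clock_time_mono p (by omega)

theorem exists_silence_le (hadj : N.graph.Adj p q) (hp : X.Correct p) (hq : X.Correct q) :
    ∃ K : ℤ, ∀ᶠ n in atTop, N.clock p (X.time n) - (X.state n p).lastContact q ≤ K := by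
  obtain ⟨t₀, B, h⟩ := X.exists_receive_within hadj.symm hq hp
  refine ⟨⌈N.rate p * (B + 1)⌉ + 1, ?_⟩
  filter_upwards [X.time_diverges.eventually_ge_atTop (t₀ + B + 1)] with n hn
  -- The extra unit of time makes the receipt strictly earlier than event `n`, so that it is already
  -- recorded in `state n`.
  obtain ⟨i, m, hi, hm, hti, htm⟩ := h (X.time n - B - 1) (by linarith)
  have hmn : m < n := X.lt_of_time_lt (by linarith)
  have h1 := X.le_lastContact hadj hm hi hmn
  have h2 : X.time i ≤ X.time m := X.time_mono (X.receive_spec hm).2.1.le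
  have hrate := N.rate_pos p
  have h3 : N.clock p (X.time n) < N.clock p (X.time m) + ⌈N.rate p * (B + 1)⌉ + 1 + 1 := by
    have h4 : ((N.clock p (X.time n) : ℤ) : ℝ) ≤ N.rate p * X.time n + N.offset p :=
      Int.floor_le _
    have h5 : N.rate p * X.time m + N.offset p < N.clock p (X.time m) + 1 :=
      Int.lt_floor_add_one _
    have h6 := Int.le_ceil (N.rate p * (B + 1))
    have h7 : N.rate p * X.time n ≤ N.rate p * (X.time m + (B + 1)) := by
      gcongr
      linarith
    have : ((N.clock p (X.time n) : ℤ) : ℝ) <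
        N.clock p (X.time m) + ⌈N.rate p * (B + 1)⌉ + 1 + 1 := by linarith
    exact_mod_cast this
  omega

/-- Only a contact clears the flag, so it is still up at the first contact from `n` on, which
therefore adjusts the timeout. -/
theorem exists_receive_suspectLocal (hadj : N.graph.Adj p q) (hp : X.Correct p)
    (hq : X.Correct q) (hs : (X.state n p).suspectLocal q = true) :
    ∃ m ≥ n, (X.state m p).suspectLocal q = true ∧
      ∃ i, X.event i = .heartbeat q ∧ X.event m = .receive i p := by
  classical
  obtain ⟨m', hm', i', hi', hr'⟩ := X.exists_receive_ge hadj.symm hq hp n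
  have hex : ∃ m, n ≤ m ∧ ¬ X.NoContact m q p := ⟨m', hm', fun h => h i' hr' hi'⟩
  obtain ⟨l, ⟨hnm, hc⟩, hmin⟩ : ∃ l, (n ≤ l ∧ ¬ X.NoContact l q p) ∧
      ∀ m < l, ¬ (n ≤ m ∧ ¬ X.NoContact m q p) :=
    ⟨Nat.find hex, Nat.find_spec hex, fun m hm => Nat.find_min hex hm⟩
  have hkeep : ∀ m ≥ n, m ≤ l → (X.state m p).suspectLocal q = true := by
    intro m hm
    induction m, hm using Nat.le_induction with
    | base => exact fun _ => hs
    | succ m hm ih =>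
      intro hlt
      rcases X.timer_cases hadj m with ⟨-, -, h | h⟩ | h
      · rw [h]
        exact ih (by omega)
      · exact h.1
      · exact absurd ⟨hm, h.1⟩ (hmin m hlt)
  refine ⟨_, hnm, hkeep _ hnm le_rfl, ?_⟩
  simp only [NoContact] at hc
  push Not at hc
  obtain ⟨i, h1, h2⟩ := hc
  exact ⟨i, h2, h1⟩

/-- A correct neighbor is eventually never suspected. -/
theorem eventually_not_suspectLocal_of_correct (hadj : N.graph.Adj p q) (hp : X.Correct p)
    (hq : X.Correct q) : ∀ᶠ n in atTop, (X.state n p).suspectLocal q = false := by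
  obtain ⟨K, hK⟩ := X.exists_silence_le hadj hp hq
  obtain ⟨M, hM⟩ := eventually_atTop.1 hK
  by_contra hnot
  have hfreq : ∀ n, ∃ m ≥ n, (X.state m p).suspectLocal q = true := by
    intro n
    by_contra! h
    exact hnot (eventually_atTop.2 ⟨n, fun m hm => by simpa using h m hm⟩)
  -- If suspicions recur forever, each withdrawal replaces the timeout by twice a silence at least
  -- as long, so the timeout is unbounded.
  have hgrow : ∀ b : ℕ, ∃ n ≥ M, (b : ℤ) ≤ (X.state n p).timeout q := by
    intro b
    induction b with
    | zero => exact ⟨M, le_rfl, (X.timer_invariant hadj M).1.le⟩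
    | succ b ih =>
      obtain ⟨n, hn, hb⟩ := ih
      obtain ⟨m, hm, hs⟩ := hfreq n
      obtain ⟨l, hl, hsl, i, hi, hr⟩ := X.exists_receive_suspectLocal hadj hp hq hs
      refine ⟨l + 1, by omega, ?_⟩
      rw [(X.timer_of_receive hadj hr hi).2.2 hsl]
      have h1 : (X.state n p).timeout q ≤ (X.state l p).timeout q :=
        X.timeout_mono hadj (hm.trans hl)
      obtain ⟨h2, h3⟩ := X.timer_invariant hadj l
      have := h3 hsl
      push_cast
      omega
  -- A later suspicion would require a silence of at least `K + 1`.
  obtain ⟨n, hn, hb⟩ := hgrow (K + 1).toNat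
  obtain ⟨m, hm, hs⟩ := hfreq n
  have h1 : (X.state n p).timeout q ≤ (X.state m p).timeout q := X.timeout_mono hadj hm
  have h2 := (X.timer_invariant hadj m).2 hs
  have h3 := hM m (hn.trans hm)
  omega

end Execution

end Heartbeat

/-! ### Knowledge of paths and induction on the distance. -/

namespace Heartbeat

namespace Execution

variable {V : Type*} {N : Network V} (X : Execution N) {p q r : V} {k n i : ℕ}

open Filter

theorem paths_mono (p r : V) : Monotone fun n => (X.state n p).paths r := by
  refine monotone_nat_of_le_succ fun n => ?_
  rcases X.step_cases n p with h | ⟨-, h⟩ | ⟨_, _, -, -, -, -, h⟩ | ⟨_, -, -, h⟩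
  · rw [h]
  · rw [h]
  · exact h.paths_subset r
  · rw [h]; exact le_rfl

theorem isSimplePath (n : ℕ) :
    ∀ p r, ∀ π ∈ (X.state n p).paths r, IsSimplePath N.graph r p π := by
  induction n using Nat.strong_induction_on with
  | _ n ih =>
    intro p
    cases n with
    | zero =>
      intro r π hπ
      rw [X.state_zero] at hπ
      unfold initialState at hπ
      dsimp only at hπ
      split_ifs at hπ with h1 h2
      · subst h1
        obtain rfl := hπ
        simp [IsSimplePath]
      · obtain rfl := hπ
        simp [IsSimplePath, h1, h2]
      · exact hπ.elim
    | succ n =>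
      have ihn := ih n n.lt_succ_self p
      rcases X.step_cases n p with h | ⟨-, h⟩ | ⟨i, q, -, -, hadj, hi, h⟩ | ⟨_, -, -, h⟩
      · rwa [h]
      · rwa [h]
      · exact h.isSimplePath hadj (ih i (by omega) q) ihn
      · rw [h]; exact ihn

theorem suspectLocal_self (n : ℕ) (p : V) : (X.state n p).suspectLocal p = false := by
  induction n with
  | zero => rw [X.state_zero]; rfl
  | succ n ih =>
    rcases X.step_cases n p with h | ⟨-, h⟩ | ⟨i, q, -, -, hadj, -, h⟩ | ⟨q, hadj, -, h⟩
    · rw [h, ih]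
    · rw [h]; exact ih
    · rw [h.suspectLocal_self hadj (X.isSimplePath i q), ih]
    · rw [h]
      simp [expireEffect, hadj.ne, ih]

theorem singleton_mem_paths (n : ℕ) (p : V) : [p] ∈ (X.state n p).paths p := by
  refine X.paths_mono p p (Nat.zero_le n) ?_
  dsimp only
  rw [X.state_zero]
  simp [initialState]

theorem pair_mem_paths (n : ℕ) (h : N.graph.Adj r p) : [r, p] ∈ (X.state n p).paths r := by
  refine X.paths_mono p r (Nat.zero_le n) ?_
  dsimp only
  rw [X.state_zero]
  simp [initialState, h.ne, h]

theorem suspect_self (n : ℕ) (p : V) : (X.state n p).suspect p = false := by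
  induction n with
  | zero => rw [X.state_zero]; rfl
  | succ n ih =>
    rcases X.step_cases n p with h | ⟨-, h⟩ | ⟨_, _, -, -, -, -, h⟩ | ⟨_, -, -, h⟩
    · rw [h, ih]
    · rw [h]; exact ih
    · exact h.suspect_eq_false (X.singleton_mem_paths (n + 1) p) (X.suspectLocal_self _ _)
        (by simp)
    · rw [h]; exact ih

theorem not_adj_of_isDist (hp : X.Correct p) (h : IsDist N.graph X.Correct (k + 2) r p) :
    ¬ N.graph.Adj p r :=
  fun hadj => h.2 1 (by omega) (.step (.refl r) hadj.symm hp)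

/-- Eventually every correct node knows shortest paths through correct nodes. -/
theorem eventually_hasGoodPath (hp : X.Correct p) (h : IsDist N.graph X.Correct k r p) :
    ∀ᶠ n in atTop, HasGoodPath N.graph X.Correct k r p ((X.state n p).paths r) := by
  induction k generalizing p with
  | zero =>
    obtain rfl := h.1.eq_of_zero
    exact .of_forall fun n => ⟨[r], X.singleton_mem_paths n r, rfl, by
      simpa using Reach.refl _⟩
  | succ k ih =>
    obtain ⟨q, hq, hadj, -⟩ := h.pred
    cases k with
    -- Receipts do not touch the paths of neighbors; the initial path `[r, p]` serves.
    | zero =>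
      obtain rfl := hq.1.eq_of_zero
      refine .of_forall fun n => HasGoodPath.concat (P := {[r]}) h
        ⟨[r], rfl, rfl, by simpa using Reach.refl _⟩ hadj hp ?_
      rintro π rfl -
      exact X.pair_mem_paths n hadj
    | succ k =>
      have hqc := hq.target_ok
      obtain ⟨M, hM⟩ := eventually_atTop.1 (X.eventually_receive p (ih hqc hq))
      obtain ⟨n, hn, i, hi, hr⟩ := X.exists_receive_ge hadj hqc hp M
      have hgood := (hM n hn i hr).concat h hadj hp fun π hπ hpπ =>
        (X.receiveEffect hr hi).append_mem_paths (X.not_adj_of_isDist hp h) hπ hpπ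
      filter_upwards [eventually_ge_atTop (n + 1)] with n' hn'
      exact hgood.mono (X.paths_mono p r hn')

theorem eventually_forall_hasGoodPath [Finite V] (k : ℕ) :
    ∀ᶠ n in atTop, ∀ p, X.Correct p → ∀ j < k, ∀ r, IsDist N.graph X.Correct j r p →
      HasGoodPath N.graph X.Correct j r p ((X.state n p).paths r) := by
  refine eventually_all.2 fun p => eventually_imp_distrib_left.2 fun hp =>
    (Set.finite_Iio k).eventually_all.2 fun j _ => eventually_all.2 fun r =>
      eventually_imp_distrib_left.2 fun hd => X.eventually_hasGoodPath hp hd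

/-- The flags of nodes at distance `k + 2` are eventually right if those of nearer nodes are. -/
theorem eventually_suspectLocal_iff [Finite V] (hp : X.Correct p)
    (hdist : IsDist N.graph X.Correct (k + 2) r p)
    (hacc : ∀ᶠ n in atTop, ∀ p, X.Correct p →
      Accurate N.graph X.Correct (k + 2) p (X.state n p).suspectLocal) :
    ∀ᶠ n in atTop, ((X.state n p).suspectLocal r = true ↔ ¬ X.Correct r) := by
  have hnadj := X.not_adj_of_isDist hp hdist
  have hgood : ∀ᶠ n in atTop, (∀ p, X.Correct p →
      Accurate N.graph X.Correct (k + 2) p (X.state n p).suspectLocal) ∧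
      (∀ p, X.Correct p → ∀ j < k + 3, ∀ r, IsDist N.graph X.Correct j r p →
        HasGoodPath N.graph X.Correct j r p ((X.state n p).paths r)) ∧
      ∀ q, X.event n = .heartbeat q → X.Correct q :=
    hacc.and ((X.eventually_forall_hasGoodPath _).and X.eventually_heartbeat_correct)
  obtain ⟨M, hM⟩ := eventually_atTop.1 (hgood.and (X.eventually_receive p hgood))
  obtain ⟨q, hq, hadj, -⟩ := hdist.pred
  -- Message `i` comes from the predecessor of `p` on a shortest walk, so `h' ≤ k + 1 < k + 2` and
  -- the right flag is copied.
  obtain ⟨n, hn, i, hi, hr⟩ := X.exists_receive_ge hadj (hq.target_ok) hp M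
  obtain ⟨⟨hs, hpath, -⟩, hmsg⟩ := hM n hn
  obtain ⟨hm, hmpath, hqc⟩ := hmsg i hr
  have hqc := hqc q hi
  have hset : (X.state (n + 1) p).suspectLocal r = true ↔ ¬ X.Correct r :=
    (X.receiveEffect hr hi).suspectLocal_iff_of_lt hadj hqc (hs p hp) (X.isSimplePath n p)
      (hm q hqc) (X.isSimplePath i q) (fun j hj => hpath p hp j (by omega))
      (hpath p hp _ (by omega) r hdist) hdist
      (hopFromMsg_lt ((hm q hqc).mono (Nat.le_succ _)) (hmpath q hqc _ (by omega) r hq) hdist)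
      hnadj
  refine eventually_atTop.2 ⟨n + 1, fun l hl => ?_⟩
  induction l, hl using Nat.le_induction with
  | base => exact hset
  | succ l hl ih =>
    rcases X.step_cases l p with h | ⟨-, h⟩ | ⟨i, q, hr, hi, hadj, -, h⟩ | ⟨q, hadj, -, h⟩
    · rwa [h]
    · rwa [h]
    · obtain ⟨⟨hs, hpath, -⟩, hmsg⟩ := hM l (by omega)
      obtain ⟨hm, -, hqc⟩ := hmsg i hr
      have hqc := hqc q hi
      exact h.suspectLocal_iff hadj hqc (hs p hp) (hm q hqc) (X.isSimplePath i q)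
        (fun j hj => hpath p hp j (by omega)) (hpath p hp _ (by omega) r hdist) hnadj ih
    · rw [h]
      -- Timers concern neighbors only, so an expiry cannot spoil the flag of `r`.
      have hne : r ≠ q := fun h => hnadj (h ▸ hadj)
      simpa [expireEffect, hne] using ih

theorem eventually_accurate [Finite V] (k : ℕ) : ∀ᶠ n in atTop, ∀ p, X.Correct p →
    Accurate N.graph X.Correct k p (X.state n p).suspectLocal := by
  induction k with
  | zero => exact .of_forall fun n p _ j hj => absurd hj (Nat.not_lt_zero j)
  | succ k ih =>
    have hlast : ∀ᶠ n in atTop, ∀ p, X.Correct p → ∀ r, IsDist N.graph X.Correct k r p →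
        ((X.state n p).suspectLocal r = true ↔ ¬ X.Correct r) := by
      refine eventually_all.2 fun p => eventually_imp_distrib_left.2 fun hp =>
        eventually_all.2 fun r => eventually_imp_distrib_left.2 fun hd => ?_
      match k with
      | 0 =>
        obtain rfl := hd.1.eq_of_zero
        exact .of_forall fun n => by simp [X.suspectLocal_self n r, hp]
      | 1 =>
        have hadj := hd.1.adj_of_one.symm
        by_cases hr : X.Correct r
        · filter_upwards [X.eventually_not_suspectLocal_of_correct hadj hp hr] with n hn
          simp [hn, hr]
        · filter_upwards [X.eventually_suspectLocal_of_not_correct hadj hp hr] with n hn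
          simp [hn, hr]
      | k + 2 => exact X.eventually_suspectLocal_iff hp hd ih
    filter_upwards [ih, hlast] with n h1 h2 p hp j hj r hr
    obtain ⟨i, hi, hd⟩ := hr.exists_isDist
    rcases (show i ≤ k by omega).eq_or_lt with rfl | hlt
    · exact h2 p hp r hd
    · exact h1 p hp i hlt r hd.1

theorem eventually_not_suspect [Finite V] (hp : X.Correct p) (hr : X.Correct r)
    (h : Reach N.graph X.Correct k r p) : ∀ᶠ n in atTop, (X.state n p).suspect r = false := by
  obtain ⟨k, -, hd⟩ := h.exists_isDist
  cases k with
  | zero =>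
    obtain rfl := hd.1.eq_of_zero
    exact .of_forall fun n => X.suspect_self n r
  | succ k =>
    obtain ⟨q, hq, hadj, -⟩ := hd.pred
    have hqc : X.Correct q := by
      cases k with
      | zero => exact hq.1.eq_of_zero ▸ hr
      | succ k => exact hq.target_ok
    -- Range `k + 2` covers `r` itself, at distance `k + 1`, and the nearer nodes of the good path.
    obtain ⟨M, hM⟩ := eventually_atTop.1
      ((X.eventually_accurate (k + 2)).and (X.eventually_hasGoodPath hp hd))
    have hreceive : ∀ n ≥ M, ∀ i q, ReceiveEffect N.graph p q (N.clock p (X.time n))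
        (X.state i q).message (X.state n p) (X.state (n + 1) p) →
        (X.state (n + 1) p).suspect r = false := by
      intro n hn i q he
      obtain ⟨hacc, π, hπ, -, hall⟩ := hM (n + 1) (by omega)
      refine he.suspect_eq_false hπ ?_ fun u hu hne => ?_
      · simpa [hr] using hacc p hp (k + 1) (by omega) r hd.1
      · obtain ⟨hok, j, hj, hreach⟩ := (hall u hu).2 hne
        simpa [hok] using hacc p hp j (by omega) u hreach
    -- `suspect` is recomputed only on receipt, so one further message is needed to replace a stale
    -- value. Distance 0 is separate because an isolated node may receive none.
    obtain ⟨n, hn, i, hi, hrc⟩ := X.exists_receive_ge hadj hqc hp M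
    refine eventually_atTop.2 ⟨n + 1, fun l hl => ?_⟩
    induction l, hl using Nat.le_induction with
    | base => exact hreceive n hn i q (X.receiveEffect hrc hi)
    | succ l hl ih =>
      rcases X.step_cases l p with h | ⟨-, h⟩ | ⟨i, q, -, -, -, -, h⟩ | ⟨q, -, -, h⟩
      · rwa [h]
      · rwa [h]
      · exact hreceive l (by omega) i q h
      · rw [h]; exact ih

/-! ### Components of the final network graph and real time. -/

theorem mem_finalNetworkGraph_verts : p ∈ X.finalNetworkGraph.verts ↔ X.Correct p := by
  simp [finalNetworkGraph]

theorem exists_reach_of_walk {a b : X.finalNetworkGraph.verts}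
    (w : X.finalNetworkGraph.coe.Walk a b) : ∃ k, Reach N.graph X.Correct k a b := by
  induction w with
  | nil => exact ⟨0, .refl _⟩
  | @cons a b c hadj w ih =>
    obtain ⟨k, hk⟩ := ih
    exact ⟨k + 1, hk.cons (X.finalNetworkGraph.coe_adj_sub _ _ hadj)
      (X.mem_finalNetworkGraph_verts.1 b.2)⟩

theorem eventually_not_suspect_of_connected [Finite V] (hp : p ∈ X.finalNetworkGraph.verts)
    (hq : q ∈ X.finalNetworkGraph.verts)
    (h : X.finalNetworkGraph.coe.Reachable ⟨p, hp⟩ ⟨q, hq⟩) :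
    ∀ᶠ n in atTop, (X.state n q).suspect p = false := by
  obtain ⟨k, hk⟩ := X.exists_reach_of_walk h.some
  exact X.eventually_not_suspect (X.mem_finalNetworkGraph_verts.1 hq)
    (X.mem_finalNetworkGraph_verts.1 hp) hk

/-- A configuration in force at `t` is closed by an event no earlier than `t`, so its index exceeds
`M`. -/
theorem not_suspectsAt {M : ℕ} (h : ∀ n ≥ M, (X.state n p).suspect q = false) {t : ℝ}
    (ht : X.time M < t) : ¬ X.SuspectsAt t p q := by
  rintro ⟨n, ⟨-, hn⟩, hs⟩
  rw [h n (X.lt_of_time_lt (ht.trans_le hn)).le] at hs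
  cases hs

end Execution

end Heartbeat

theorem mainTheorem2 {V : Type*} [Finite V] (N : Heartbeat.Network V)
    (X : Heartbeat.Execution N) :
    ∃ tf : ℝ, ∀ t : ℝ, tf < t → ∀ (p q : V) (hp : p ∈ X.finalNetworkGraph.verts)
      (hq : q ∈ X.finalNetworkGraph.verts),
      X.finalNetworkGraph.coe.connectedComponentMk ⟨p, hp⟩ =
        X.finalNetworkGraph.coe.connectedComponentMk ⟨q, hq⟩ →
      ¬ X.SuspectsAt t p q ∧ ¬ X.SuspectsAt t q p := by
  have h : ∀ᶠ n in Filter.atTop, ∀ (p q : V) (hp : p ∈ X.finalNetworkGraph.verts)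
      (hq : q ∈ X.finalNetworkGraph.verts),
      X.finalNetworkGraph.coe.Reachable ⟨p, hp⟩ ⟨q, hq⟩ → (X.state n q).suspect p = false := by
    simp only [Filter.eventually_all]
    exact fun p q hp hq => X.eventually_not_suspect_of_connected hp hq
  obtain ⟨M, hM⟩ := Filter.eventually_atTop.1 h
  refine ⟨X.time M, fun t ht p q hp hq hpq => ?_⟩
  have hr := SimpleGraph.ConnectedComponent.eq.1 hpq
  exact ⟨X.not_suspectsAt (fun n hn => hM n hn q p hq hp hr.symm) ht,
    X.not_suspectsAt (fun n hn => hM n hn p q hp hq hr) ht⟩
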